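/- For $A\in\mathbb Z^{m\times n}$ and $b\in\mathbb Z^m$ let $P=\{x\in\mathbb R^n : Ax=b,\ x\ge 0\}$, let $P_I=\mathrm{conv}(P\cap\mathbb Z^n)$ be its integer hull, let $\|A\|_\infty$ be the largest absolute value of an entry of $A$, and let $\log$ be the logarithm with base two. There is an absolute constant $C>0$ such that for all $m,n$, all $A\in\mathbb Z^{m\times n}$ with $A\neq 0$ and all $b\in\mathbb Z^m$ the following holds. The number of vertices (extreme points) of $P_I$ is finite. Unless $m=\|A\|_\infty=1$, it is at most $$(mn\|A\|_\infty)^{C\,m^2\log(\sqrt m\,\|A\|_\infty)},$$ and in all cases, including $m=\|A\|_\infty=1$, it is at most $$(mn\|A\|_\infty)^{C\,m^2\log(2\sqrt m\,\|A\|_\infty)}.$$ In particular, for fixed $m$ and $\|A\|_\infty$ it is bounded by a polynomial in $n$: for all $m,a\in\mathbb N$ there is a polynomial $p$ such that for all $n$, all nonzero $A\in\mathbb Z^{m\times n}$ with $\|A\|_\infty=a$ and all $b\in\mathbb Z^m$, $P_I$ has at most $p(n)$ vertices. -/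

import Mathlib

open scoped Matrix

/-- The largest absolute value of an entry of an integer matrix (`0` if there is no entry). -/
def maxAbsEntry {m n : ℕ} (A : Matrix (Fin m) (Fin n) ℤ) : ℕ :=
  Finset.univ.sup fun p : Fin m × Fin n => (A p.1 p.2).natAbs

/-- The polyhedron `{x ∈ ℝⁿ : A x = b, x ≥ 0}` in standard form. -/
def stdPolyhedron {m n : ℕ} (A : Matrix (Fin m) (Fin n) ℤ) (b : Fin m → ℤ) :
    Set (Fin n → ℝ) :=
  {x | A.map (fun a : ℤ => (a : ℝ)) *ᵥ x = (fun i => (b i : ℝ)) ∧ ∀ j, 0 ≤ x j}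

/-- The integer points `ℤⁿ` of `ℝⁿ`. -/
def integerPoints (n : ℕ) : Set (Fin n → ℝ) :=
  {x | ∃ z : Fin n → ℤ, x = fun j => (z j : ℝ)}

/-- The integer hull `conv (P ∩ ℤⁿ)` of a set `P ⊆ ℝⁿ`. -/
def integerHull {n : ℕ} (P : Set (Fin n → ℝ)) : Set (Fin n → ℝ) :=
  convexHull ℝ (P ∩ integerPoints n)

/-- The vertices of a convex set, that is, its extreme points. -/
def hullVertices {n : ℕ} (Q : Set (Fin n → ℝ)) : Set (Fin n → ℝ) :=
  Set.extremePoints ℝ Q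

/-! ### Small integer kernel vectors. -/

section Kernel

/-! Write D for `maxAbsEntry A`. A vertex z of the integer hull is an integer point that is not the
midpoint of z + w and z - w, so no nonzero integer kernel vector w satisfies |w| ≤ z; this is
`IsRigid`. Two applications of the pigeonhole principle exploit this. If the support of z exceeded s
= O(m log(mD)), two 0/1 vectors on it would have the same image, and their difference would be a
forbidden w. If the columns at the coordinates of size at least K = (sD)^m were dependent, Siegel's
lemma would give a forbidden w with entries at most K. Hence the part of z below K determines the
rest, and z is encoded by min(z, K), a function into {0, ..., K} with at most s nonzero values.
There are at most (n(K+1))^s of these. -/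

/-- Pigeonhole form of Siegel's lemma: an integer matrix whose image of the box `[0, B]^ι` is
smaller than the box has a nonzero integer kernel vector with entries of absolute value at most
`B`. -/
theorem exists_kernel_vector_of_card_lt {ρ ι : Type*} [Fintype ρ] [Fintype ι]
    (A : Matrix ρ ι ℤ) (D B : ℕ) (hA : ∀ i j, (A i j).natAbs ≤ D)
    (h : (Fintype.card ι * D * B + 1) ^ Fintype.card ρ < (B + 1) ^ Fintype.card ι) :
    ∃ w : ι → ℤ, w ≠ 0 ∧ A *ᵥ w = 0 ∧ ∀ j, |w j| ≤ B := by
  classical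
  -- The shift by `max (-A i j) 0 * B` moves each term into [0, DB]. It does not depend on `x`, so
  -- it cancels when two images are compared.
  have key : ∀ (x : ι → Fin (B + 1)) (i : ρ) (j : ι),
      0 ≤ A i j * ((x j : ℕ) : ℤ) + max (-A i j) 0 * B ∧
        A i j * ((x j : ℕ) : ℤ) + max (-A i j) 0 * B ≤ D * B := by
    intro x i j
    have h1 : ((x j : ℕ) : ℤ) ≤ B := by exact_mod_cast Nat.lt_succ_iff.mp (x j).2
    have h0 : (0 : ℤ) ≤ ((x j : ℕ) : ℤ) := by positivity
    have h2 := hA i j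
    have h3 : |A i j| ≤ D := by rw [Int.abs_eq_natAbs]; exact_mod_cast h2
    obtain ⟨h4, h5⟩ := abs_le.mp h3
    rcases le_total (A i j) 0 with h6 | h6
    · rw [max_eq_left (by linarith)]
      constructor <;> nlinarith
    · rw [max_eq_right (by linarith)]
      constructor <;> nlinarith
  let F : (ι → Fin (B + 1)) → ρ → ℤ := fun x i =>
    ∑ j, (A i j * ((x j : ℕ) : ℤ) + max (-A i j) 0 * B)
  have hF0 : ∀ x i, 0 ≤ F x i := fun x i => Finset.sum_nonneg fun j _ => (key x i j).1
  have hF1 : ∀ x i, F x i ≤ (Fintype.card ι * D * B : ℕ) := by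
    intro x i
    calc F x i ≤ ∑ _j : ι, (D * B : ℤ) := Finset.sum_le_sum fun j _ => (key x i j).2
      _ = _ := by simp [mul_assoc]
  let f : (ι → Fin (B + 1)) → ρ → Fin (Fintype.card ι * D * B + 1) := fun x i =>
    ⟨(F x i).toNat, by have := hF0 x i; have := hF1 x i; omega⟩
  obtain ⟨x, y, hxy, hf⟩ := Fintype.exists_ne_map_eq_of_card_lt f (by simpa using h)
  refine ⟨fun j => ((x j : ℕ) : ℤ) - ((y j : ℕ) : ℤ), ?_, ?_, ?_⟩
  · intro h0
    apply hxy
    funext j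
    have := congrFun h0 j
    simp only [Pi.zero_apply] at this
    apply Fin.ext
    omega
  · funext i
    have h1 : (F x i).toNat = (F y i).toNat := congrArg Fin.val (congrFun hf i)
    have h2 : F x i = F y i := by
      have := hF0 x i
      have := hF0 y i
      omega
    simp only [F, Finset.sum_add_distrib] at h2
    simp only [Matrix.mulVec, dotProduct, mul_sub, Finset.sum_sub_distrib, Pi.zero_apply]
    linarith
  · intro j
    have := (x j).2
    have := (y j).2
    refine abs_le.2 ⟨?_, ?_⟩ <;> dsimp only <;> omega

/-- Finitely many vectors spanning a subspace contain a spanning subfamily whose length is the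
dimension of the span. -/
theorem exists_subfamily_span_eq {ρ ι : Type*} [Finite ρ] [Finite ι] (R : ρ → ι → ℚ) :
    ∃ (r : ℕ) (g : Fin r → ρ), r = Module.finrank ℚ (Submodule.span ℚ (Set.range R)) ∧
      Submodule.span ℚ (Set.range fun k => R (g k)) = Submodule.span ℚ (Set.range R) := by
  obtain ⟨f, hf, hspan, -⟩ := Submodule.exists_fun_fin_finrank_span_eq ℚ (Set.range R)
  choose g hg using hf
  exact ⟨_, g, rfl, by simp only [hg]; exact hspan⟩

/-- An integer matrix with a nontrivial kernel has a nonzero integer kernel vector whose entries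
are bounded in terms of its size and its entries, whatever its rank. -/
theorem exists_bounded_kernel_vector {ρ ι : Type*} [Fintype ρ] [Fintype ι]
    (A : Matrix ρ ι ℤ) (D : ℕ) (hD : 0 < D) (hA : ∀ i j, (A i j).natAbs ≤ D)
    (v : ι → ℤ) (hv : v ≠ 0) (hAv : A *ᵥ v = 0) :
    ∃ w : ι → ℤ, w ≠ 0 ∧ A *ᵥ w = 0 ∧
      ∀ j, |w j| ≤ ((Fintype.card ι * D) ^ Fintype.card ρ : ℕ) := by
  classical
  let R : ρ → ι → ℚ := fun i j => (A i j : ℚ)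
  have hker : ∀ w : ι → ℤ, ∀ i, (∑ j, R i j * (w j : ℚ) = 0 ↔ (A *ᵥ w) i = 0) := by
    intro w i
    simp only [R, Matrix.mulVec, dotProduct]
    exact_mod_cast Iff.rfl
  have hspan_ker : ∀ (w : ι → ℤ) (S : Set (ι → ℚ)), (∀ u ∈ S, ∑ j, u j * (w j : ℚ) = 0) →
      ∀ u ∈ Submodule.span ℚ S, ∑ j, u j * (w j : ℚ) = 0 := by
    intro w S hS u hu
    induction hu using Submodule.span_induction with
    | mem u hu => exact hS u hu
    | zero => simp
    | add a b _ _ ha hb => simp [add_mul, Finset.sum_add_distrib, ha, hb]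
    | smul c a _ ha => simp [mul_assoc, ← Finset.mul_sum, ha]
  -- Keeping only a basis of the row space leaves the kernel unchanged and makes the rows fewer than
  -- the columns, as the pigeonhole count requires.
  obtain ⟨r, g, hr, hg⟩ := exists_subfamily_span_eq R
  have hr_row : r ≤ Fintype.card ρ := hr.trans_le (finrank_range_le_card R)
  have hr_col : r < Fintype.card ι := by
    -- If the rows spanned everything, `v` would be orthogonal to itself.
    by_contra hlt
    have htop : Submodule.span ℚ (Set.range R) = ⊤ := by
      apply Submodule.eq_top_of_finrank_eq
      apply le_antisymm (Submodule.finrank_le _)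
      rw [Module.finrank_fintype_fun_eq_card, ← hr]
      exact not_lt.mp hlt
    have hvv : ∑ j, (v j : ℚ) * (v j : ℚ) = 0 := by
      refine hspan_ker v (Set.range R) ?_ (fun j => (v j : ℚ)) (by rw [htop]; trivial)
      rintro _ ⟨i, rfl⟩
      exact (hker v i).2 (congrFun hAv i)
    apply hv
    funext j
    have := (Finset.sum_eq_zero_iff_of_nonneg fun j _ => mul_self_nonneg (v j : ℚ)).1 hvv j
      (Finset.mem_univ j)
    simpa using this
  have hc : 0 < Fintype.card ι := by omega
  set c := Fintype.card ι * D with hcdef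
  have hcpos : 0 < c := Nat.mul_pos hc hD
  set B := c ^ Fintype.card ρ with hB
  have hcard : (Fintype.card ι * D * B + 1) ^ Fintype.card (Fin r)
      < (B + 1) ^ Fintype.card ι := by
    rw [Fintype.card_fin, ← hcdef]
    -- The one spare column supplies a factor B + 1, which beats c^r ≤ B.
    calc (c * B + 1) ^ r ≤ (c * (B + 1)) ^ r := Nat.pow_le_pow_left (by nlinarith) r
      _ = c ^ r * (B + 1) ^ r := mul_pow _ _ _
      _ < (B + 1) * (B + 1) ^ r := by
        apply Nat.mul_lt_mul_of_pos_right _ (by positivity)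
        exact Nat.lt_succ_of_le (Nat.pow_le_pow_right hcpos hr_row)
      _ = (B + 1) ^ (r + 1) := by ring
      _ ≤ (B + 1) ^ Fintype.card ι := Nat.pow_le_pow_right (by omega) hr_col
  obtain ⟨w, hw0, hw, hwB⟩ := exists_kernel_vector_of_card_lt (A.submatrix g id) D B
    (fun i j => hA _ _) hcard
  refine ⟨w, hw0, ?_, hwB⟩
  funext i
  refine (hker w i).1 (hspan_ker w (Set.range fun k => R (g k)) ?_ (R i) ?_)
  · rintro _ ⟨k, rfl⟩
    exact (hker w (g k)).2 (congrFun hw k)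
  · rw [hg]
    exact Submodule.subset_span ⟨i, rfl⟩

/-- Extending a vector by zero along an injection of column indices. -/
theorem mulVec_extend {ρ ι κ : Type*} [Fintype ι] [Fintype κ] (A : Matrix ρ κ ℤ) (e : ι → κ)
    (he : Function.Injective e) (w : ι → ℤ) :
    A *ᵥ Function.extend e w 0 = A.submatrix id e *ᵥ w := by
  funext i
  refine (Fintype.sum_of_injective e he _ _ (fun j hj => ?_) fun j => ?_).symm
  · rw [Function.extend_apply' _ _ _ (by simpa using hj)]
    simp
  · rw [he.extend_apply]
    rfl

end Kernel

/-! ### Rigid vectors: small support and truncation. -/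

section Rigid

variable {m n : ℕ}

/-- A vector `z` is rigid for `A` if it is not the midpoint of two distinct nonnegative integer
vectors in its fibre under `A`. -/
def IsRigid (A : Matrix (Fin m) (Fin n) ℤ) (z : Fin n → ℤ) : Prop :=
  (∀ j, 0 ≤ z j) ∧ ∀ w : Fin n → ℤ, A *ᵥ w = 0 → (∀ j, |w j| ≤ z j) → w = 0

/-- A rigid vector has no nonzero kernel vector supported on coordinates where it is large. -/
theorem IsRigid.not_kernel_of_le {A : Matrix (Fin m) (Fin n) ℤ} {z : Fin n → ℤ}
    (hz : IsRigid A z) {B : ℕ} (L : Finset (Fin n)) (hL : ∀ j ∈ L, (B : ℤ) ≤ z j)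
    (w : L → ℤ) (hw : A.submatrix id (Subtype.val : L → Fin n) *ᵥ w = 0)
    (hB : ∀ j, |w j| ≤ B) : w = 0 := by
  have hinj : Function.Injective (Subtype.val : L → Fin n) := Subtype.val_injective
  have h := hz.2 (Function.extend Subtype.val w 0) (by rw [mulVec_extend A _ hinj, hw]) ?_
  · funext j
    have := congrFun h j
    rwa [hinj.extend_apply] at this
  · intro j
    by_cases hj : j ∈ L
    · have : Function.extend (Subtype.val : L → Fin n) w 0 j = w ⟨j, hj⟩ :=
        hinj.extend_apply w 0 ⟨j, hj⟩
      rw [this]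
      exact (hB _).trans (hL j hj)
    · rw [Function.extend_apply' _ _ _ (by simpa using hj)]
      simpa using hz.1 j

/-- The bound on the support of a rigid vector. -/
def supportBound (m D : ℕ) : ℕ := m * (4 * (Nat.log 2 (m * D) + 1))

/-- The threshold above which the columns of the large coordinates are independent. -/
def largeBound (m D : ℕ) : ℕ := (supportBound m D * D) ^ m

theorem supportBound_pos {m D : ℕ} (hm : 0 < m) : 0 < supportBound m D := by
  unfold supportBound; positivity

/-- This is the pigeonhole inequality for 0/1 vectors. With l = `Nat.log 2 (m * D) + 1`, each row
needs l bits for mD and at most 3l bits for the factor 4l, which explains the 4 in `supportBound`.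
-/
theorem pow_lt_two_pow_supportBound {m D : ℕ} (hm : 0 < m) :
    (supportBound m D * D * 1 + 1) ^ m < 2 ^ supportBound m D := by
  unfold supportBound
  set l := Nat.log 2 (m * D) + 1 with hl
  have h1 : m * D + 1 ≤ 2 ^ l := Nat.lt_pow_succ_log_self (by norm_num) _
  have h2 : 4 * l ≤ 2 ^ (3 * l) := by
    have : l < 2 ^ l := Nat.lt_two_pow_self
    have h3 : 4 ≤ 2 ^ (2 * l) := by
      calc 4 = 2 ^ 2 := by norm_num
        _ ≤ 2 ^ (2 * l) := Nat.pow_le_pow_right (by norm_num) (by omega)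
    calc 4 * l ≤ 2 ^ (2 * l) * 2 ^ l := Nat.mul_le_mul h3 this.le
      _ = 2 ^ (3 * l) := by rw [← pow_add]; congr 1; ring
  have h3 : m * (4 * l) * D * 1 + 1 < 2 ^ (4 * l) := by
    calc m * (4 * l) * D * 1 + 1 = (m * D) * (4 * l) + 1 := by ring
      _ < (m * D + 1) * (4 * l) := by rw [add_mul, one_mul]; omega
      _ ≤ 2 ^ l * 2 ^ (3 * l) := Nat.mul_le_mul h1 h2
      _ = 2 ^ (4 * l) := by rw [← pow_add]; congr 1; ring
  calc _ < (2 ^ (4 * l)) ^ m := Nat.pow_lt_pow_left h3 hm.ne'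
    _ = 2 ^ (m * (4 * l)) := by rw [← pow_mul, mul_comm]

/-- Rigid vectors have small support. -/
theorem IsRigid.card_support_le {A : Matrix (Fin m) (Fin n) ℤ} {z : Fin n → ℤ}
    (hz : IsRigid A z) (hm : 0 < m) {D : ℕ} (hA : ∀ i j, (A i j).natAbs ≤ D) :
    (Finset.univ.filter fun j => z j ≠ 0).card ≤ supportBound m D := by
  by_contra! hlt
  obtain ⟨T, hT, hcard⟩ := Finset.exists_subset_card_eq hlt.le
  obtain ⟨w, hw0, hw, hwB⟩ := exists_kernel_vector_of_card_lt
    (A.submatrix id (Subtype.val : T → Fin n)) D 1 (fun i j => hA _ _)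
    (by simpa [hcard] using pow_lt_two_pow_supportBound (D := D) hm)
  refine hw0 (hz.not_kernel_of_le T (fun j hj => ?_) w hw hwB)
  have h1 := hz.1 j
  have h2 := (Finset.mem_filter.1 (hT hj)).2
  push_cast
  omega

/-- A rigid vector is determined by its truncation at `largeBound` among all vectors in its
fibre. -/
theorem IsRigid.eq_of_min_eq {A : Matrix (Fin m) (Fin n) ℤ} {z y : Fin n → ℤ}
    (hz : IsRigid A z) (hm : 0 < m) {D : ℕ} (hD : 0 < D)
    (hA : ∀ i j, (A i j).natAbs ≤ D) (hfib : A *ᵥ z = A *ᵥ y)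
    (h : ∀ j, min (z j) (largeBound m D) = min (y j) (largeBound m D)) : z = y := by
  by_contra hne
  set L := Finset.univ.filter fun j => (largeBound m D : ℤ) ≤ z j with hLdef
  have hinj : Function.Injective (Subtype.val : L → Fin n) := Subtype.val_injective
  have hout : ∀ j, j ∉ L → z j = y j := by
    intro j hj
    have h1 : ¬ (largeBound m D : ℤ) ≤ z j := by simpa [hLdef] using hj
    have := h j
    omega
  have hKpos : 0 < largeBound m D := by
    have := supportBound_pos (D := D) hm
    unfold largeBound; positivity
  -- Since the threshold is positive, `L` lies in the support of `z`; thus the kernel bound depends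
  -- on m and D but not on n.
  have hLs : Fintype.card L ≤ supportBound m D := by
    rw [Fintype.card_coe]
    refine (Finset.card_le_card fun j hj => ?_).trans (hz.card_support_le hm hA)
    have := (Finset.mem_filter.1 hj).2
    simp only [Finset.mem_filter, Finset.mem_univ, true_and]
    omega
  let v : L → ℤ := fun j => z j - y j
  have hext : Function.extend (Subtype.val : L → Fin n) v 0 = z - y := by
    funext j
    by_cases hj : j ∈ L
    · exact hinj.extend_apply v 0 ⟨j, hj⟩
    · rw [Function.extend_apply' _ _ _ (by simpa using hj)]
      simp [hout j hj]
  have hv : v ≠ 0 := by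
    intro hv
    apply hne
    have : z - y = 0 := by
      rw [← hext, hv]
      funext j
      by_cases hj : j ∈ L
      · exact hinj.extend_apply (0 : L → ℤ) 0 ⟨j, hj⟩
      · rw [Function.extend_apply' _ _ _ (by simpa using hj)]
    exact sub_eq_zero.1 this
  have hAv : A.submatrix id (Subtype.val : L → Fin n) *ᵥ v = 0 := by
    rw [← mulVec_extend A _ hinj, hext, Matrix.mulVec_sub, hfib, sub_self]
  obtain ⟨w, hw0, hw, hwB⟩ := exists_bounded_kernel_vector _ D hD (fun i j => hA _ _) v hv hAv
  refine hw0 (hz.not_kernel_of_le L (fun j hj => (Finset.mem_filter.1 hj).2) w hw fun j => ?_)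
  refine (hwB j).trans ?_
  rw [Fintype.card_fin]
  exact_mod_cast Nat.pow_le_pow_left (Nat.mul_le_mul_right D hLs) m

end Rigid

/-! ### Counting truncated vectors. -/

section Counting

/-- There are at most `(n (k + 1))^s` functions `Fin n → Fin (k + 1)` with at most `s` nonzero
values. -/
theorem card_sparse_functions_le {n k s : ℕ} (hn : 0 < n)
    (G : Finset (Fin n → Fin (k + 1)))
    (hG : ∀ g ∈ G, (Finset.univ.filter fun j => g j ≠ 0).card ≤ s) :
    G.card ≤ (n * (k + 1)) ^ s := by
  classical
  -- Decodes a list of s (position, value) pairs, with value 0 at unlisted positions.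
  let Φ : (Fin s → Fin n × Fin (k + 1)) → Fin n → Fin (k + 1) := fun c j =>
    if h : ∃ i, (c i).1 = j then (c h.choose).2 else 0
  have hsub : G ⊆ Finset.univ.image Φ := by
    intro g hg
    have : Nonempty (Fin n) := ⟨⟨0, hn⟩⟩
    obtain ⟨e, he⟩ : ∃ e : Fin s → Fin n, ∀ j, g j ≠ 0 → ∃ i, e i = j := by
      set T := Finset.univ.filter fun j => g j ≠ 0 with hT
      let ι := Fin.castLEEmb (hG g hg)
      let φ : Fin T.card → Fin n := fun i => (T.equivFin.symm i : Fin n)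
      -- Padding with position 0 is harmless: the value stored with each position is that of `g`, so
      -- repetitions agree.
      refine ⟨Function.extend ι φ fun _ => ⟨0, hn⟩, fun j hj => ?_⟩
      have hjT : j ∈ T := by simp [hT, hj]
      refine ⟨ι (T.equivFin ⟨j, hjT⟩), ?_⟩
      rw [ι.injective.extend_apply]
      simp [φ]
    refine Finset.mem_image.2 ⟨fun i => (e i, g (e i)), Finset.mem_univ _, ?_⟩
    funext j
    by_cases h : ∃ i, e i = j
    · simp only [Φ]
      rw [dif_pos h]
      exact congrArg g h.choose_spec
    · simp only [Φ]
      rw [dif_neg h]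
      by_contra hne
      exact h (he j (Ne.symm hne))
  calc G.card ≤ (Finset.univ.image Φ).card := Finset.card_le_card hsub
    _ ≤ Finset.univ.card := Finset.card_image_le
    _ = (n * (k + 1)) ^ s := by simp

/-- The rigid vectors in one fibre of `A` are finite in number, with an explicit bound. -/
theorem finite_rigid_fibre {m n : ℕ} (hm : 0 < m) (hn : 0 < n) (A : Matrix (Fin m) (Fin n) ℤ)
    (b : Fin m → ℤ) {D : ℕ} (hD : 0 < D) (hA : ∀ i j, (A i j).natAbs ≤ D)
    (V : Set (Fin n → ℤ)) (hV : ∀ z ∈ V, IsRigid A z ∧ A *ᵥ z = b) :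
    V.Finite ∧ V.ncard ≤ (n * (largeBound m D + 1)) ^ supportBound m D := by
  classical
  set K := largeBound m D with hK
  let code : (Fin n → ℤ) → Fin n → Fin (K + 1) := fun z j =>
    ⟨(min (z j) K).toNat, by omega⟩
  have hinj : Set.InjOn code V := by
    intro z hz y hy hzy
    refine (hV z hz).1.eq_of_min_eq hm hD hA ((hV z hz).2.trans (hV y hy).2.symm) fun j => ?_
    have h1 : (min (z j) K).toNat = (min (y j) K).toNat := congrArg Fin.val (congrFun hzy j)
    have h2 := (hV z hz).1.1 j
    have h3 := (hV y hy).1.1 j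
    omega
  have hfin : V.Finite := Set.Finite.of_finite_image (Set.toFinite _) hinj
  refine ⟨hfin, ?_⟩
  rw [← hinj.ncard_image, Set.ncard_eq_toFinset_card']
  apply card_sparse_functions_le hn
  intro g hg
  obtain ⟨z, hz, rfl⟩ := Set.mem_toFinset.1 hg
  refine (Finset.card_le_card fun j hj => ?_).trans ((hV z hz).1.card_support_le hm hA)
  simp only [Finset.mem_filter, Finset.mem_univ, true_and] at hj ⊢
  intro h0
  apply hj
  apply Fin.ext
  simp [code, h0]

end Counting

/-! ### From vertices to rigid vectors. -/

section Vertices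

variable {m n : ℕ}

theorem natAbs_le_maxAbsEntry (A : Matrix (Fin m) (Fin n) ℤ) (i : Fin m) (j : Fin n) :
    (A i j).natAbs ≤ maxAbsEntry A :=
  Finset.le_sup (f := fun p : Fin m × Fin n => (A p.1 p.2).natAbs) (Finset.mem_univ (i, j))

theorem dimensions_pos_of_ne_zero {A : Matrix (Fin m) (Fin n) ℤ} (hA : A ≠ 0) :
    0 < m ∧ 0 < n ∧ 0 < maxAbsEntry A := by
  obtain ⟨i, j, hij⟩ : ∃ i j, A i j ≠ 0 := by
    by_contra! h
    exact hA (Matrix.ext h)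
  refine ⟨i.pos, j.pos, lt_of_lt_of_le ?_ (natAbs_le_maxAbsEntry A i j)⟩
  exact Int.natAbs_pos.2 hij

theorem intCast_mem_stdPolyhedron_iff (A : Matrix (Fin m) (Fin n) ℤ) (b : Fin m → ℤ)
    (z : Fin n → ℤ) :
    (fun j => (z j : ℝ)) ∈ stdPolyhedron A b ↔ A *ᵥ z = b ∧ ∀ j, 0 ≤ z j := by
  simp only [stdPolyhedron, Set.mem_ofPred_eq, funext_iff, Matrix.mulVec, dotProduct,
    Matrix.map_apply]
  norm_cast

/-- Every vertex of the integer hull is a rigid integer point of the fibre of `A` over `b`. -/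
theorem exists_rigid_of_mem_hullVertices {A : Matrix (Fin m) (Fin n) ℤ} {b : Fin m → ℤ}
    {x : Fin n → ℝ} (hx : x ∈ hullVertices (integerHull (stdPolyhedron A b))) :
    ∃ z : Fin n → ℤ, (IsRigid A z ∧ A *ᵥ z = b) ∧ (fun j => (z j : ℝ)) = x := by
  obtain ⟨hxP, z, rfl⟩ := extremePoints_convexHull_subset hx
  obtain ⟨hAz, hz⟩ := (intCast_mem_stdPolyhedron_iff A b z).1 hxP
  refine ⟨z, ⟨⟨hz, fun w hw hwz => ?_⟩, hAz⟩, rfl⟩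
  have hmem : ∀ u : Fin n → ℤ, A *ᵥ u = 0 → (∀ j, |u j| ≤ z j) →
      (fun j => ((z j + u j : ℤ) : ℝ)) ∈ integerHull (stdPolyhedron A b) := by
    intro u hu huz
    apply subset_convexHull
    refine ⟨(intCast_mem_stdPolyhedron_iff A b (fun j => z j + u j)).2 ⟨?_, fun j => ?_⟩, _, rfl⟩
    · have : A *ᵥ (z + u) = b := by rw [Matrix.mulVec_add, hu, hAz, add_zero]
      exact this
    · have := abs_le.1 (huz j)
      linarith
  have h1 := hmem w hw hwz
  have h2 := hmem (-w) (by rw [Matrix.mulVec_neg, hw, neg_zero]) (by simpa using hwz)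
  have h3 := hx.2 h1 h2 ⟨1 / 2, 1 / 2, by norm_num, by norm_num, by norm_num, by
    funext j
    simp
    ring⟩
  funext j
  have := congrFun h3 j
  simpa using this

theorem hullVertices_finite_and_ncard_le {A : Matrix (Fin m) (Fin n) ℤ} (hA : A ≠ 0)
    (b : Fin m → ℤ) :
    (hullVertices (integerHull (stdPolyhedron A b))).Finite ∧
      (hullVertices (integerHull (stdPolyhedron A b))).ncard ≤
        (n * (largeBound m (maxAbsEntry A) + 1)) ^ supportBound m (maxAbsEntry A) := by
  obtain ⟨hm, hn, hD⟩ := dimensions_pos_of_ne_zero hA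
  set V : Set (Fin n → ℤ) := {z | IsRigid A z ∧ A *ᵥ z = b}
  obtain ⟨hfin, hcard⟩ := finite_rigid_fibre hm hn A b hD (natAbs_le_maxAbsEntry A) V
    fun z hz => hz
  have hsub : hullVertices (integerHull (stdPolyhedron A b)) ⊆
      (fun (z : Fin n → ℤ) j => (z j : ℝ)) '' V := fun x hx => exists_rigid_of_mem_hullVertices hx
  have himg := hfin.image fun (z : Fin n → ℤ) j => (z j : ℝ)
  exact ⟨himg.subset hsub,
    (Set.ncard_le_ncard hsub himg).trans ((Set.ncard_image_le hfin).trans hcard)⟩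

/-- With a single variable the polyhedron has at most one point. -/
theorem hullVertices_ncard_le_one {A : Matrix (Fin m) (Fin 1) ℤ} (hA : A ≠ 0)
    (b : Fin m → ℤ) :
    (hullVertices (integerHull (stdPolyhedron A b))).ncard ≤ 1 := by
  rw [Set.ncard_le_one (hullVertices_finite_and_ncard_le hA b).1]
  intro x hx y hy
  obtain ⟨i, hi⟩ : ∃ i, A i 0 ≠ 0 := by
    by_contra! h
    exact hA (Matrix.ext fun i j => by rw [Subsingleton.elim j 0]; exact h i)
  have hx' := congrFun (extremePoints_convexHull_subset hx).1.1 i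
  have hy' := congrFun (extremePoints_convexHull_subset hy).1.1 i
  simp only [Matrix.mulVec, dotProduct, Finset.univ_unique, Finset.sum_singleton,
    Matrix.map_apply, Fin.default_eq_zero] at hx' hy'
  funext j
  rw [Subsingleton.elim j 0]
  exact mul_left_cancel₀ (Int.cast_ne_zero.2 hi) (hx'.trans hy'.symm)

end Vertices

/-! ### Explicit exponents. -/

section Estimates

/-- All constants are absorbed into powers of N = mnD ≥ 2: the base is at most N^(6m) and the
exponent is 4ml, whence 24. -/
theorem count_le_pow {m n D : ℕ} (hm : 0 < m) (hn : 0 < n) (hD : 0 < D)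
    (hN : 2 ≤ m * n * D) :
    (n * (largeBound m D + 1)) ^ supportBound m D ≤
      (m * n * D) ^ (24 * m ^ 2 * (Nat.log 2 (m * D) + 1)) := by
  set N := m * n * D with hNdef
  set l := Nat.log 2 (m * D) + 1 with hl
  have hmD : 0 < m * D := by positivity
  have hmDN : m * D ≤ N := by rw [hNdef]; nlinarith
  have hnN : n ≤ N := by rw [hNdef]; nlinarith
  have hlN : l ≤ m * D := Nat.log_lt_self 2 hmD.ne'
  have hsD : supportBound m D * D ≤ N ^ 4 := by
    calc supportBound m D * D = 2 * 2 * l * (m * D) := by rw [supportBound, ← hl]; ring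
      _ ≤ N * N * N * N := by
        gcongr
        all_goals omega
      _ = N ^ 4 := by ring
  have hK : largeBound m D ≤ N ^ (4 * m) := by
    rw [largeBound, pow_mul]
    exact Nat.pow_le_pow_left hsD m
  have h1 : n * (largeBound m D + 1) ≤ N ^ (6 * m) := by
    have hpos : 1 ≤ N ^ (4 * m) := Nat.one_le_pow _ _ (by omega)
    calc n * (largeBound m D + 1) ≤ N * (N * N ^ (4 * m)) := by
          apply Nat.mul_le_mul hnN
          calc largeBound m D + 1 ≤ 2 * N ^ (4 * m) := by omega
            _ ≤ N * N ^ (4 * m) := Nat.mul_le_mul_right _ hN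
      _ = N ^ (4 * m + 2) := by ring
      _ ≤ N ^ (6 * m) := Nat.pow_le_pow_right (by omega) (by omega)
  calc _ ≤ (N ^ (6 * m)) ^ supportBound m D := Nat.pow_le_pow_left h1 _
    _ = N ^ (24 * m ^ 2 * l) := by rw [← pow_mul, supportBound, ← hl]; congr 1; ring

theorem logb_sqrt_mul {m D : ℕ} (hm : 0 < m) (hD : 0 < D) :
    Real.logb 2 (Real.sqrt m * D) = Real.logb 2 m / 2 + Real.logb 2 D := by
  have hm' : (0 : ℝ) < m := by exact_mod_cast hm
  have hD' : (0 : ℝ) < D := by exact_mod_cast hD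
  rw [Real.logb_mul (Real.sqrt_pos.2 hm').ne' hD'.ne']
  simp only [Real.logb, Real.log_sqrt hm'.le]
  ring

theorem logb_two_mul_sqrt_mul {m D : ℕ} (hm : 0 < m) (hD : 0 < D) :
    Real.logb 2 (2 * Real.sqrt m * D) = 1 + Real.logb 2 (Real.sqrt m * D) := by
  have hm' : (0 : ℝ) < m := by exact_mod_cast hm
  have hD' : (0 : ℝ) < D := by exact_mod_cast hD
  have := Real.sqrt_pos.2 hm'
  rw [mul_assoc, Real.logb_mul (by norm_num) (by positivity),
    Real.logb_self_eq_one (by norm_num)]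

/-- The square root halves log m, and the factor 2 restores it. -/
theorem natLog_add_one_le {m D : ℕ} (hm : 0 < m) (hD : 0 < D) :
    ((Nat.log 2 (m * D) + 1 : ℕ) : ℝ) ≤ 2 * Real.logb 2 (2 * Real.sqrt m * D) := by
  have hm' : (1 : ℝ) ≤ m := by exact_mod_cast hm
  have hD' : (1 : ℝ) ≤ D := by exact_mod_cast hD
  have h1 : (Nat.log 2 (m * D) : ℝ) ≤ Real.logb 2 m + Real.logb 2 D := by
    rw [← Real.logb_mul (by positivity) (by positivity)]
    exact_mod_cast Real.natLog_le_logb (m * D) 2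
  have h2 : 0 ≤ Real.logb 2 (D : ℝ) := Real.logb_nonneg (by norm_num) hD'
  rw [logb_two_mul_sqrt_mul hm hD, logb_sqrt_mul hm hD]
  push_cast
  linarith

/-- At m = D = 1 the logarithm vanishes; otherwise it is bounded away from 0 and can absorb additive
constants. -/
theorem half_le_logb_sqrt_mul {m D : ℕ} (hm : 0 < m) (hD : 0 < D) (h : m ≠ 1 ∨ D ≠ 1) :
    1 / 2 ≤ Real.logb 2 (Real.sqrt m * D) := by
  have hone : ∀ k : ℕ, 0 < k → 0 ≤ Real.logb 2 (k : ℝ) := fun k hk =>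
    Real.logb_nonneg (by norm_num) (by exact_mod_cast hk)
  have htwo : ∀ k : ℕ, 0 < k → k ≠ 1 → 1 ≤ Real.logb 2 (k : ℝ) := by
    intro k hk hk1
    have hk2 : (2 : ℝ) ≤ k := by exact_mod_cast (by omega : 2 ≤ k)
    rw [Real.le_logb_iff_rpow_le (by norm_num) (by positivity), Real.rpow_one]
    exact hk2
  rw [logb_sqrt_mul hm hD]
  have h1 := hone m hm
  have h2 := hone D hD
  rcases h with h | h
  · have := htwo m hm h
    linarith
  · have := htwo D hD h
    linarith

theorem ncard_hullVertices_le_rpow {m n : ℕ} {A : Matrix (Fin m) (Fin n) ℤ} (hA : A ≠ 0)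
    (b : Fin m → ℤ) {E : ℝ}
    (hE : 24 * (m : ℝ) ^ 2 * ((Nat.log 2 (m * maxAbsEntry A) + 1 : ℕ) : ℝ) ≤ E) :
    ((hullVertices (integerHull (stdPolyhedron A b))).ncard : ℝ) ≤
      ((m : ℝ) * (n : ℝ) * (maxAbsEntry A : ℝ)) ^ E := by
  obtain ⟨hm, hn, hD⟩ := dimensions_pos_of_ne_zero hA
  have hcast : (m : ℝ) * (n : ℝ) * (maxAbsEntry A : ℝ) = ((m * n * maxAbsEntry A : ℕ) : ℝ) := by
    push_cast; rfl
  have hNpos : 1 ≤ m * n * maxAbsEntry A := by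
    have : 0 < m * n * maxAbsEntry A := by positivity
    exact this
  have hN1 : (1 : ℝ) ≤ ((m * n * maxAbsEntry A : ℕ) : ℝ) := by exact_mod_cast hNpos
  have hE0 : 0 ≤ E := le_trans (by positivity) hE
  rw [hcast]
  -- When mnD = 1 the right side is 1, so constants cannot be absorbed; but then n = 1 and there is
  -- at most one vertex.
  rcases hNpos.eq_or_lt with h | h
  · obtain rfl : n = 1 := Nat.eq_one_of_mul_eq_one_left (Nat.eq_one_of_mul_eq_one_right h.symm)
    exact le_trans (by exact_mod_cast hullVertices_ncard_le_one hA b)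
      (Real.one_le_rpow hN1 hE0)
  · have h1 := (hullVertices_finite_and_ncard_le hA b).2.trans (count_le_pow hm hn hD h)
    calc ((hullVertices (integerHull (stdPolyhedron A b))).ncard : ℝ)
        ≤ ((m * n * maxAbsEntry A : ℕ) : ℝ) ^
          (24 * m ^ 2 * (Nat.log 2 (m * maxAbsEntry A) + 1)) := by exact_mod_cast h1
      _ ≤ ((m * n * maxAbsEntry A : ℕ) : ℝ) ^ E := by
        rw [← Real.rpow_natCast]
        apply Real.rpow_le_rpow_of_exponent_le hN1
        refine le_trans (le_of_eq ?_) hE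
        push_cast
        ring

end Estimates

theorem mainTheorem4 :
    (∃ C : ℝ, 0 < C ∧
      ∀ (m n : ℕ) (A : Matrix (Fin m) (Fin n) ℤ) (b : Fin m → ℤ), A ≠ 0 →
        (hullVertices (integerHull (stdPolyhedron A b))).Finite ∧
        ((m ≠ 1 ∨ maxAbsEntry A ≠ 1) →
          ((hullVertices (integerHull (stdPolyhedron A b))).ncard : ℝ) ≤
            ((m : ℝ) * (n : ℝ) * (maxAbsEntry A : ℝ)) ^
              (C * ((m : ℝ) ^ 2 * Real.logb 2 (Real.sqrt (m : ℝ) * (maxAbsEntry A : ℝ))))) ∧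
        ((hullVertices (integerHull (stdPolyhedron A b))).ncard : ℝ) ≤
          ((m : ℝ) * (n : ℝ) * (maxAbsEntry A : ℝ)) ^
            (C * ((m : ℝ) ^ 2 *
              Real.logb 2 (2 * Real.sqrt (m : ℝ) * (maxAbsEntry A : ℝ))))) ∧
    (∀ m a : ℕ, ∃ p : Polynomial ℕ,
      ∀ (n : ℕ) (A : Matrix (Fin m) (Fin n) ℤ) (b : Fin m → ℤ), A ≠ 0 → maxAbsEntry A = a →
        (hullVertices (integerHull (stdPolyhedron A b))).ncard ≤ p.eval n) := by
  -- 144 = 24 · 6, where 6 comes from 2(1 + x) ≤ 6x for x ≥ 1/2, with x = log(√m D).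
  refine ⟨⟨144, by norm_num, fun m n A b hA => ?_⟩, fun m a => ?_⟩
  · obtain ⟨hm, -, hD⟩ := dimensions_pos_of_ne_zero hA
    have hlog := natLog_add_one_le hm hD
    have hlog_nonneg : 0 ≤ Real.logb 2 (2 * Real.sqrt m * maxAbsEntry A) := by
      have : (0 : ℝ) ≤ ((Nat.log 2 (m * maxAbsEntry A) + 1 : ℕ) : ℝ) := by positivity
      linarith
    have hm2 : (0 : ℝ) ≤ (m : ℝ) ^ 2 := by positivity
    refine ⟨(hullVertices_finite_and_ncard_le hA b).1, fun hne => ?_, ?_⟩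
    · apply ncard_hullVertices_le_rpow hA b
      have hhalf := half_le_logb_sqrt_mul hm hD hne
      rw [logb_two_mul_sqrt_mul hm hD] at hlog
      have := mul_le_mul_of_nonneg_left
        (show ((Nat.log 2 (m * maxAbsEntry A) + 1 : ℕ) : ℝ) ≤
          6 * Real.logb 2 (Real.sqrt m * maxAbsEntry A) by linarith) hm2
      linarith
    · apply ncard_hullVertices_le_rpow hA b
      have := mul_le_mul_of_nonneg_left
        (show ((Nat.log 2 (m * maxAbsEntry A) + 1 : ℕ) : ℝ) ≤
          6 * Real.logb 2 (2 * Real.sqrt m * maxAbsEntry A) by linarith) hm2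
      linarith
  · refine ⟨(Polynomial.X * Polynomial.C (largeBound m a + 1)) ^ supportBound m a, ?_⟩
    rintro n A b hA rfl
    rw [Polynomial.eval_pow, Polynomial.eval_mul, Polynomial.eval_X, Polynomial.eval_C]
    exact (hullVertices_finite_and_ncard_le hA b).2
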